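/- All Hilbert spaces are finite dimensional and $\log$ is to base $2$. For states $\rho,\sigma$ and $\varepsilon\in(0,1)$ let $$\mathrm{D}_{\mathrm H}^{\varepsilon}(\rho\|\sigma)=\sup\Big\{\log\tfrac{1}{\mathrm{Tr}(\Lambda\sigma)} : 0\preceq\Lambda\preceq \mathrm{I},\ \mathrm{Tr}(\Lambda\rho)\ge 1-\varepsilon\Big\}.$$ An $(R_1,R_2,\eta_1,\eta_2)$ entanglement-assisted code for a quantum channel (completely positive trace-preserving map) $\mathcal N_{A\to BC}$ consists of a pure state $|\theta\rangle_{E_{A_1}E_B}$ shared by Alice and Bob, a pure state $|\theta\rangle_{E_{A_2}E_C}$ shared by Alice and Charlie, an encoding channel $\mathcal E: M_1M_2E_{A_1}E_{A_2}\to A$ for Alice, and decoding channels $\mathcal D_B: BE_B\to M_1'$ for Bob and $\mathcal D_C: CE_C\to M_2'$ for Charlie, such that for every message pair $(m_1,m_2)\in[2^{R_1}]\times[2^{R_2}]$ (where $[2^R]=\{1,\dots,\lfloor 2^R\rfloor\}$), when $(m_1,m_2)$ is sent, $\Pr(M_1'\ne m_1)\le\eta_1$ and $\Pr(M_2'\neq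 m_2)\le\eta_2$. **Theorem 6.** Fix a quantum channel $\mathcal N_{A\to BC}$ and $\varepsilon_1,\varepsilon_2,\delta\in(0,1)$ with $\delta\le\min(\varepsilon_1,\varepsilon_2)$. For every quantum state $\psi_{AB'C'}$ satisfying $\psi_{B'C'}=\psi_{B'}\otimes\psi_{C'}$ and all $R_1,R_2\ge 0$, there exists an $(R_1,R_2,\varepsilon_1+\delta,\varepsilon_2+\delta)$ entanglement-assisted code for $\mathcal N_{A\to BC}$ if $$R_1\le \mathrm{D}_{\mathrm H}^{\varepsilon_1}\big(\mathrm{Tr}_C\,\mathcal N_{A\to BC}(\psi_{AB'})\,\big\|\,\mathrm{Tr}_C\,\mathcal N_{A\to BC}(\psi_A)\otimes\psi_{B'}\big)-\log\frac{4\varepsilon_1}{\delta^2},$$ $$R_2\le \mathrm{D}_{\mathrm H}^{\varepsilon_2}\big(\mathrm{Tr}_B\,\mathcal N_{A\to BC}(\psi_{AC'})\,\big\|\,\mathrm{Tr}_B\,\mathcal N_{A\to BC}(\psi_A)\otimes\psi_{C'}\big)-\log\frac{4\varepsilon_2}{\delta^2}.$$ -/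

import Mathlib

open scoped Kronecker ComplexOrder

universe u

namespace QBroadcast

noncomputable section

/-! Registers are finite index types; operators on the Hilbert space of the register `A` are the
complex matrices indexed by `A`, and the composite register `AB` is indexed by `A × B`. -/

section General

variable {A B C E F R : Type*}

/-- Quantum states (density matrices). -/
def IsState [Fintype A] (ρ : Matrix A A ℂ) : Prop :=
  ρ.PosSemidef ∧ ρ.trace = 1

/-- Unit vectors. -/
def IsKet [Fintype A] (v : A → ℂ) : Prop :=
  ∑ a, ‖v a‖ ^ 2 = 1

/-- The pure state `|v⟩⟨v|`. -/
def pureState (v : A → ℂ) : Matrix A A ℂ :=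
  Matrix.vecMulVec v (star v)

/-- `Tr_B` on `AB`. -/
def trRight [Fintype B] : Matrix (A × B) (A × B) ℂ →ₗ[ℂ] Matrix A A ℂ where
  toFun X := Matrix.of fun a a' => ∑ b, X (a, b) (a', b)
  map_add' X Y := by ext; simp [Finset.sum_add_distrib]
  map_smul' c X := by ext; simp [Finset.mul_sum]

/-- `Tr_A` on `AB`. -/
def trLeft [Fintype A] : Matrix (A × B) (A × B) ℂ →ₗ[ℂ] Matrix B B ℂ where
  toFun X := Matrix.of fun b b' => ∑ a, X (a, b) (a, b')
  map_add' X Y := by ext; simp [Finset.sum_add_distrib]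
  map_smul' c X := by ext; simp [Finset.mul_sum]

/-- The marginal on `AE` of an operator on `A(EF)`. -/
def marg12 [Fintype F] (X : Matrix (A × (E × F)) (A × (E × F)) ℂ) :
    Matrix (A × E) (A × E) ℂ :=
  Matrix.of fun x y => ∑ f, X (x.1, (x.2, f)) (y.1, (y.2, f))

/-- The marginal on `AF` of an operator on `A(EF)`. -/
def marg13 [Fintype E] (X : Matrix (A × (E × F)) (A × (E × F)) ℂ) :
    Matrix (A × F) (A × F) ℂ :=
  Matrix.of fun x y => ∑ e, X (x.1, (e, x.2)) (y.1, (e, y.2))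

/-- The action `N ⊗ id_R` of a linear map `N` on operators, on the first factor of `AR`. -/
def actLeft (N : Matrix A A ℂ →ₗ[ℂ] Matrix B B ℂ) (X : Matrix (A × R) (A × R) ℂ) :
    Matrix (B × R) (B × R) ℂ :=
  Matrix.of fun x y => N (Matrix.of fun a a' => X (a, x.2) (a', y.2)) x.1 y.1

/-- Quantum channels: completely positive trace preserving linear maps. -/
structure IsChannel [Fintype A] [Fintype B] (N : Matrix A A ℂ →ₗ[ℂ] Matrix B B ℂ) : Prop where
  completely_positive : ∀ (k : ℕ) (X : Matrix (A × Fin k) (A × Fin k) ℂ),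
    X.PosSemidef → (actLeft N X).PosSemidef
  trace_preserving : ∀ X : Matrix A A ℂ, (N X).trace = X.trace

/-- Tests: `0 ≼ Λ ≼ I` with `Tr (Λ ρ) ≥ 1 - ε`. -/
def IsTest [Fintype A] [DecidableEq A] (ε : ℝ) (ρ Λ : Matrix A A ℂ) : Prop :=
  Λ.PosSemidef ∧ (1 - Λ).PosSemidef ∧ 1 - ε ≤ ((Λ * ρ).trace).re

/-- `log₂ (1 / t)` for `t ≥ 0`, with the value `+∞` at `t = 0`. -/
def logInv (t : ℝ) : EReal :=
  if t = 0 then ⊤ else ((Real.logb 2 (1 / t) : ℝ) : EReal)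

/-- The smooth quantum hypothesis testing divergence, in bits. -/
def DH [Fintype A] [DecidableEq A] (ε : ℝ) (ρ σ : Matrix A A ℂ) : EReal :=
  ⨆ (Λ : Matrix A A ℂ) (_ : IsTest ε ρ Λ), logInv ((Λ * σ).trace).re

/-- The marginal on `BE` of an operator on `(BC)(EF)`. -/
def margFirst [Fintype C] [Fintype F] (X : Matrix ((B × C) × (E × F)) ((B × C) × (E × F)) ℂ) :
    Matrix (B × E) (B × E) ℂ :=
  Matrix.of fun x y => ∑ c, ∑ f, X ((x.1, c), (x.2, f)) ((y.1, c), (y.2, f))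

/-- The marginal on `CF` of an operator on `(BC)(EF)`. -/
def margSecond [Fintype B] [Fintype E] (X : Matrix ((B × C) × (E × F)) ((B × C) × (E × F)) ℂ) :
    Matrix (C × F) (C × F) ℂ :=
  Matrix.of fun x y => ∑ b, ∑ e, X ((b, x.1), (e, x.2)) ((b, y.1), (e, y.2))

end General

/-- Entanglement assisted codes for the broadcast channel with input `A` and outputs `B`, `C`, with
`k₁` messages for Bob and `k₂` messages for Charlie. Alice shares one pure state with Bob and another
pure state with Charlie; the messages are held in registers with computational bases indexed by
`Fin k₁`, `Fin k₂`. -/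
structure EACode (A B C : Type u) [Fintype A] [Fintype B] [Fintype C] (k₁ k₂ : ℕ) where
  /-- Alice's share of the entanglement with Bob -/
  EA₁ : Type u
  /-- Bob's share -/
  EB : Type u
  /-- Alice's share of the entanglement with Charlie -/
  EA₂ : Type u
  /-- Charlie's share -/
  EC : Type u
  [fintypeEA₁ : Fintype EA₁]
  [fintypeEB : Fintype EB]
  [fintypeEA₂ : Fintype EA₂]
  [fintypeEC : Fintype EC]
  /-- the entangled state shared by Alice and Bob -/
  θ₁ : EA₁ × EB → ℂ
  /-- the entangled state shared by Alice and Charlie -/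
  θ₂ : EA₂ × EC → ℂ
  isKet_θ₁ : IsKet θ₁
  isKet_θ₂ : IsKet θ₂
  /-- Alice's encoding operation `M₁M₂E_{A₁}E_{A₂} → A` -/
  enc : Matrix ((Fin k₁ × Fin k₂) × (EA₁ × EA₂)) ((Fin k₁ × Fin k₂) × (EA₁ × EA₂)) ℂ →ₗ[ℂ]
    Matrix A A ℂ
  isChannel_enc : IsChannel enc
  /-- Bob's decoding operation `BE_B → M'₁` -/
  decB : Matrix (B × EB) (B × EB) ℂ →ₗ[ℂ] Matrix (Fin k₁) (Fin k₁) ℂ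
  isChannel_decB : IsChannel decB
  /-- Charlie's decoding operation `CE_C → M'₂` -/
  decC : Matrix (C × EC) (C × EC) ℂ →ₗ[ℂ] Matrix (Fin k₂) (Fin k₂) ℂ
  isChannel_decC : IsChannel decC

namespace EACode

attribute [instance] EACode.fintypeEA₁ EACode.fintypeEB EACode.fintypeEA₂ EACode.fintypeEC

variable {A B C : Type u} [Fintype A] [Fintype B] [Fintype C] {k₁ k₂ : ℕ}

/-- The initial vector `|m₁ m₂⟩ ⊗ |θ₁⟩ ⊗ |θ₂⟩`, ordered as `(M₁M₂E_{A₁}E_{A₂})(E_B E_C)`. -/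
def initial (c : EACode A B C k₁ k₂) (m₁ : Fin k₁) (m₂ : Fin k₂) :
    ((Fin k₁ × Fin k₂) × (c.EA₁ × c.EA₂)) × (c.EB × c.EC) → ℂ :=
  fun x => (if x.1.1 = (m₁, m₂) then 1 else 0) *
    (c.θ₁ (x.1.2.1, x.2.1) * c.θ₂ (x.1.2.2, x.2.2))

/-- The joint state of `(BC)(E_B E_C)` after encoding `(m₁, m₂)` and transmission through `N`. -/
def received (c : EACode A B C k₁ k₂) (N : Matrix A A ℂ →ₗ[ℂ] Matrix (B × C) (B × C) ℂ)
    (m₁ : Fin k₁) (m₂ : Fin k₂) : Matrix ((B × C) × (c.EB × c.EC)) ((B × C) × (c.EB × c.EC)) ℂ :=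
  actLeft N (actLeft c.enc (pureState (c.initial m₁ m₂)))

/-- The probability that Bob's output differs from `m₁` when `(m₁, m₂)` was sent. -/
def errB (c : EACode A B C k₁ k₂) (N : Matrix A A ℂ →ₗ[ℂ] Matrix (B × C) (B × C) ℂ)
    (m₁ : Fin k₁) (m₂ : Fin k₂) : ℝ :=
  ∑ m ∈ Finset.univ.erase m₁, (c.decB (margFirst (c.received N m₁ m₂)) m m).re

/-- The probability that Charlie's output differs from `m₂` when `(m₁, m₂)` was sent. -/
def errC (c : EACode A B C k₁ k₂) (N : Matrix A A ℂ →ₗ[ℂ] Matrix (B × C) (B × C) ℂ)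
    (m₁ : Fin k₁) (m₂ : Fin k₂) : ℝ :=
  ∑ m ∈ Finset.univ.erase m₂, (c.decC (margSecond (c.received N m₁ m₂)) m m).re

end EACode

/-- Existence of an `(R₁, R₂, η₁, η₂)` entanglement assisted code for the broadcast channel `N`, the
message sets being `[2^R₁]` and `[2^R₂]` (of size `⌊2^R⌋`). -/
def HasEACode {A B C : Type u} [Fintype A] [Fintype B] [Fintype C]
    (N : Matrix A A ℂ →ₗ[ℂ] Matrix (B × C) (B × C) ℂ) (R₁ R₂ η₁ η₂ : ℝ) : Prop :=
  ∃ c : EACode A B C ⌊(2 : ℝ) ^ R₁⌋₊ ⌊(2 : ℝ) ^ R₂⌋₊,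
    ∀ m₁ m₂, c.errB N m₁ m₂ ≤ η₁ ∧ c.errC N m₁ m₂ ≤ η₂

end

end QBroadcast

open QBroadcast

/-! The scheme is position-based coding. Alice and Bob share one copy of the canonical purification
of ψ_{B'} for each message of Bob, and likewise Alice and Charlie for ψ_{C'}. Because ψ_{B'C'} is a
product, Bob's copy m₁ and Charlie's copy m₂ together purify ψ_{B'C'}, so some channel on Alice's
two halves produces ψ_{AB'C'} (`exists_channel_of_marginal`). Alice sends the resulting A through
the channel and discards her other halves. From Bob's side the channel output is then correlated
with copy m₁ exactly as in Tr_C N(ψ_{AB'}), and the other copies are independent of it; Charlie's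
message leaves no trace (`margFirst_actLeft`, `margSecond_actLeft`). The broadcast problem thus
splits into two separate decoding problems.

Each receiver has to find the correlated copy. A hypothesis test L accepts the right copy with
probability at least 1 - ε and a wrong one with probability Tr(Lσ), where σ is the product of the
marginals (`trace_placed_one_mul_placed`). The pretty good measurement is at least as good as a
union bound over these tests: by `pretty_good_success` its error with k messages is at most ε + (k -
1) Tr(Lσ), up to an arbitrarily small loss and without extra constant factors. The bound holds for
every message, so no averaging or expurgation is needed. A gap of log(2/δ) between rate and
divergence already suffices, and it is smaller than log(4ε/δ²) because δ ≤ ε. -/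

namespace QBroadcast

open Matrix

/-! ### Completely positive maps, Kraus maps and partial traces -/

section CP

variable {A B C J R : Type*}

/-- Complete positivity of a linear map on operators. -/
def IsCP (N : Matrix A A ℂ →ₗ[ℂ] Matrix B B ℂ) : Prop :=
  ∀ (k : ℕ) (X : Matrix (A × Fin k) (A × Fin k) ℂ), X.PosSemidef → (actLeft N X).PosSemidef

theorem IsCP.comp {N : Matrix A A ℂ →ₗ[ℂ] Matrix B B ℂ} {M : Matrix B B ℂ →ₗ[ℂ] Matrix C C ℂ}
    (hM : IsCP M) (hN : IsCP N) : IsCP (M ∘ₗ N) :=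
  fun k X hX => hM k _ (hN k X hX)

theorem IsCP.sum {N : J → Matrix A A ℂ →ₗ[ℂ] Matrix B B ℂ} {s : Finset J}
    (hN : ∀ j ∈ s, IsCP (N j)) : IsCP (∑ j ∈ s, N j) := by
  intro k X hX
  have : actLeft (∑ j ∈ s, N j) X = ∑ j ∈ s, actLeft (N j) X := by
    ext x y
    simp [actLeft, Matrix.sum_apply]
  rw [this]
  exact Matrix.posSemidef_sum s fun j hj => hN j hj k X hX

/-- Restriction of operators along a map of index sets. -/
def submatrixMap (s : B → A) : Matrix A A ℂ →ₗ[ℂ] Matrix B B ℂ where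
  toFun X := X.submatrix s s
  map_add' _ _ := rfl
  map_smul' _ _ := rfl

theorem submatrixMap_apply (s : B → A) (X : Matrix A A ℂ) : submatrixMap s X = X.submatrix s s :=
  rfl

theorem isCP_submatrixMap (s : B → A) : IsCP (submatrixMap s) :=
  fun _ _ hX => hX.submatrix (Prod.map s id)

/-- The map `X ↦ K X K†`. -/
def conjMap [Fintype A] (K : Matrix B A ℂ) : Matrix A A ℂ →ₗ[ℂ] Matrix B B ℂ where
  toFun X := K * X * Kᴴ
  map_add' X Y := by simp [Matrix.mul_add, Matrix.add_mul]
  map_smul' c X := by simp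

theorem isCP_conjMap [Fintype A] [Fintype B] (K : Matrix B A ℂ) : IsCP (conjMap K) := by
  intro k X hX
  have h := hX.mul_mul_conjTranspose_same (K ⊗ₖ (1 : Matrix (Fin k) (Fin k) ℂ))
  convert h using 1
  ext ⟨b, r⟩ ⟨b', r'⟩
  simp [actLeft, conjMap, Matrix.mul_apply, Fintype.sum_prod_type, Matrix.one_apply,
    apply_ite (starRingEnd ℂ)]

/-- The map with the Kraus operators `K j`. -/
noncomputable def krausMap [Fintype A] [Fintype J] (K : J → Matrix B A ℂ) :
    Matrix A A ℂ →ₗ[ℂ] Matrix B B ℂ :=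
  ∑ j, conjMap (K j)

theorem krausMap_apply [Fintype A] [Fintype J] (K : J → Matrix B A ℂ) (X : Matrix A A ℂ) :
    krausMap K X = ∑ j, K j * X * (K j)ᴴ := by
  simp [krausMap, conjMap]

theorem isChannel_krausMap [Fintype A] [DecidableEq A] [Fintype B] [Fintype J]
    (K : J → Matrix B A ℂ) (hK : ∑ j, (K j)ᴴ * K j = 1) : IsChannel (krausMap K) where
  completely_positive := IsCP.sum fun j _ => isCP_conjMap (K j)
  trace_preserving X := by
    have : ∀ j, (K j * X * (K j)ᴴ).trace = ((K j)ᴴ * K j * X).trace := fun j => by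
      rw [Matrix.trace_mul_comm, Matrix.mul_assoc]
    rw [krausMap_apply, Matrix.trace_sum]
    simp only [this]
    rw [← Matrix.trace_sum, ← Matrix.sum_mul, hK, Matrix.one_mul]

/-- Complete positivity is defined with ancillas `Fin k`; an enumeration of `R` transfers it to
arbitrary finite registers. -/
theorem IsChannel.posSemidef_actLeft [Fintype A] [Fintype B] [Fintype R]
    {N : Matrix A A ℂ →ₗ[ℂ] Matrix B B ℂ} (hN : IsChannel N) {X : Matrix (A × R) (A × R) ℂ}
    (hX : X.PosSemidef) : (actLeft N X).PosSemidef := by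
  let e := Fintype.equivFin R
  have h := hN.completely_positive _ _ (hX.submatrix (Prod.map id e.symm))
  have h' := h.submatrix (Prod.map id e)
  convert h' using 1
  ext x y
  simp [actLeft]

theorem trace_actLeft [Fintype A] [Fintype B] [Fintype R]
    {N : Matrix A A ℂ →ₗ[ℂ] Matrix B B ℂ} (hN : ∀ X, (N X).trace = X.trace)
    (X : Matrix (A × R) (A × R) ℂ) : (actLeft N X).trace = X.trace := by
  have h : ∀ r, ∑ b, (actLeft N X) (b, r) (b, r) = ∑ a, X (a, r) (a, r) := fun r =>
    hN (Matrix.of fun a a' => X (a, r) (a', r))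
  simp only [Matrix.trace, Matrix.diag, Fintype.sum_prod_type_right] at h ⊢
  exact Finset.sum_congr rfl fun r _ => h r

theorem trRight_actLeft [Fintype R] (N : Matrix A A ℂ →ₗ[ℂ] Matrix B B ℂ)
    (X : Matrix (A × R) (A × R) ℂ) : trRight (actLeft N X) = N (trRight X) := by
  have : trRight X = ∑ r, Matrix.of fun a a' => X (a, r) (a', r) := by
    ext a a'; simp [trRight, Matrix.sum_apply]
  rw [this, map_sum]
  ext b b'
  simp [trRight, actLeft, Matrix.sum_apply]

theorem isCP_trRight [Fintype B] : IsCP (trRight : Matrix (A × B) (A × B) ℂ →ₗ[ℂ] _) := by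
  have : (trRight : Matrix (A × B) (A × B) ℂ →ₗ[ℂ] _) =
      ∑ b, submatrixMap (fun a : A => (a, b)) := by
    ext X a a'; simp [trRight, submatrixMap_apply, Matrix.sum_apply]
  rw [this]
  exact IsCP.sum fun _ _ => isCP_submatrixMap _

theorem isCP_trLeft [Fintype A] : IsCP (trLeft : Matrix (A × B) (A × B) ℂ →ₗ[ℂ] _) := by
  have : (trLeft : Matrix (A × B) (A × B) ℂ →ₗ[ℂ] _) =
      ∑ a, submatrixMap (fun b : B => (a, b)) := by
    ext X a a'; simp [trLeft, submatrixMap_apply, Matrix.sum_apply]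
  rw [this]
  exact IsCP.sum fun _ _ => isCP_submatrixMap _

theorem trace_trRight [Fintype A] [Fintype B] (X : Matrix (A × B) (A × B) ℂ) :
    (trRight X).trace = X.trace := by
  simp [trRight, Matrix.trace, Fintype.sum_prod_type]

theorem trace_trLeft [Fintype A] [Fintype B] (X : Matrix (A × B) (A × B) ℂ) :
    (trLeft X).trace = X.trace := by
  simp [trLeft, Matrix.trace, Fintype.sum_prod_type_right]

theorem posSemidef_trLeft [Fintype A] {X : Matrix (A × B) (A × B) ℂ} (hX : X.PosSemidef) :
    (trLeft X).PosSemidef := by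
  have : trLeft X = ∑ a, X.submatrix (fun b => (a, b)) (fun b => (a, b)) := by
    ext b b'; simp [trLeft, Matrix.sum_apply]
  rw [this]
  exact Matrix.posSemidef_sum _ fun a _ => hX.submatrix _

theorem posSemidef_trRight [Fintype B] {X : Matrix (A × B) (A × B) ℂ} (hX : X.PosSemidef) :
    (trRight X).PosSemidef := by
  have : trRight X = ∑ b, X.submatrix (fun a => (a, b)) (fun a => (a, b)) := by
    ext b b'; simp [trRight, Matrix.sum_apply]
  rw [this]
  exact Matrix.posSemidef_sum _ fun a _ => hX.submatrix _

theorem IsChannel.trRight_comp [Fintype A] [Fintype B] [Fintype C]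
    {N : Matrix A A ℂ →ₗ[ℂ] Matrix (B × C) (B × C) ℂ} (hN : IsChannel N) :
    IsChannel (trRight ∘ₗ N) where
  completely_positive := isCP_trRight.comp hN.completely_positive
  trace_preserving X := by rw [LinearMap.comp_apply, trace_trRight, hN.trace_preserving]

theorem IsChannel.trLeft_comp [Fintype A] [Fintype B] [Fintype C]
    {N : Matrix A A ℂ →ₗ[ℂ] Matrix (B × C) (B × C) ℂ} (hN : IsChannel N) :
    IsChannel (trLeft ∘ₗ N) where
  completely_positive := isCP_trLeft.comp hN.completely_positive
  trace_preserving X := by rw [LinearMap.comp_apply, trace_trLeft, hN.trace_preserving]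

end CP

/-! ### Traces of positive operators, square roots -/

section Trace

variable {A : Type*} [Fintype A]

open scoped MatrixOrder in
theorem exists_eq_conjTranspose_mul_self {X : Matrix A A ℂ} (hX : X.PosSemidef) :
    ∃ R : Matrix A A ℂ, X = Rᴴ * R := by
  classical
  exact CStarAlgebra.nonneg_iff_eq_star_mul_self.mp hX.nonneg

theorem re_trace_nonneg {X : Matrix A A ℂ} (hX : X.PosSemidef) : 0 ≤ X.trace.re :=
  (Complex.le_def.mp hX.trace_nonneg).1

theorem re_trace_mul_nonneg {X Y : Matrix A A ℂ} (hX : X.PosSemidef) (hY : Y.PosSemidef) :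
    0 ≤ ((X * Y).trace).re := by
  obtain ⟨R, rfl⟩ := exists_eq_conjTranspose_mul_self hX
  rw [Matrix.mul_assoc, Matrix.trace_mul_comm]
  exact re_trace_nonneg (hY.mul_mul_conjTranspose_same R)

/-- A square root of a positive operator, together with the pseudoinverse of this root. -/
theorem exists_sqrt_pinv [DecidableEq A] {X : Matrix A A ℂ} (hX : X.PosSemidef) :
    ∃ S G : Matrix A A ℂ, S.PosSemidef ∧ G.PosSemidef ∧ S * S = X ∧ S * G = G * S ∧
      S * G * S = S := by
  let U : Matrix A A ℂ := hX.1.eigenvectorUnitary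
  have hU : Uᴴ * U = 1 := Unitary.coe_star_mul_self hX.1.eigenvectorUnitary
  let f : (A → ℝ) → Matrix A A ℂ := fun d => U * diagonal (fun i => (d i : ℂ)) * Uᴴ
  have hf : ∀ d : A → ℝ, (∀ i, 0 ≤ d i) → (f d).PosSemidef := fun d hd =>
    (PosSemidef.diagonal (fun i => by simpa using hd i)).mul_mul_conjTranspose_same U
  have hmul : ∀ d d' : A → ℝ, f d * f d' = f (d * d') := fun d d' => by
    calc f d * f d' = U * diagonal (fun i => (d i : ℂ)) * (Uᴴ * U) *
          diagonal (fun i => (d' i : ℂ)) * Uᴴ := by simp only [f, Matrix.mul_assoc]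
      _ = f (d * d') := by
        rw [hU, Matrix.mul_one, Matrix.mul_assoc U, Matrix.diagonal_mul_diagonal]
        simp [f]
  let r : A → ℝ := fun i => √(hX.1.eigenvalues i)
  refine ⟨f r, f r⁻¹, hf _ fun i => Real.sqrt_nonneg _,
    hf _ fun i => inv_nonneg.mpr (Real.sqrt_nonneg _), ?_, ?_, ?_⟩
  · rw [hmul]
    have : r * r = hX.1.eigenvalues := funext fun i => Real.mul_self_sqrt (hX.eigenvalues_nonneg i)
    rw [this]
    exact hX.1.spectral_theorem.symm
  · rw [hmul, hmul, mul_comm]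
  · rw [hmul, hmul]
    congr 1
    -- Since 0⁻¹ = 0, the pointwise inverse is the pseudoinverse, also on the kernel.
    exact funext fun i => mul_inv_mul_cancel (r i)

end Trace

/-! ### The pretty good measurement -/

section PrettyGood

variable {A J : Type*} [Fintype A] [DecidableEq A] [Fintype J]

/-- The success probability of the pretty good measurement in terms of an arbitrary test `L`; here
`S ^ 2` is the average operator and `G = S⁻¹`. -/
theorem pretty_good_success {S G ρ L : Matrix A A ℂ} (hS : S.IsHermitian) (hG : G.PosSemidef)
    (hGS : G * S = 1) (hSG : S * G = 1) (hρ : ρ.IsHermitian) (hL : L.IsHermitian)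
    (hLL : (L - L * L).PosSemidef) :
    2 * ((L * ρ).trace).re - ((L * (S * S)).trace).re ≤ ((G * ρ * G * ρ).trace).re := by
  -- Completing the square: this is the squared Hilbert-Schmidt norm of G^{1/2} (ρ - SLS) G^{1/2}.
  -- It gives Tr(GρGρ) ≥ 2 Tr(Lρ) - Tr(LSLS). The norm of the commutator of L and S then yields
  -- Tr(LSLS) ≤ Tr(L²S²), and L² ≤ L yields Tr(L²S²) ≤ Tr(LS²).
  have h1 : 0 ≤ ((G * ((ρ - S * L * S) * G * (ρ - S * L * S))).trace).re := by
    have hD : (ρ - S * L * S)ᴴ = ρ - S * L * S := by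
      simp [Matrix.mul_assoc, hS.eq, hρ.eq, hL.eq]
    refine re_trace_mul_nonneg hG ?_
    have h := hG.mul_mul_conjTranspose_same (ρ - S * L * S)
    rwa [hD] at h
  have h2 : 0 ≤ (((L * S - S * L)ᴴ * (L * S - S * L)).trace).re :=
    re_trace_nonneg (posSemidef_conjTranspose_mul_self _)
  have h3 : 0 ≤ (((L - L * L) * (S * S)).trace).re := by
    refine re_trace_mul_nonneg hLL ?_
    have h := posSemidef_conjTranspose_mul_self S
    rwa [hS.eq] at h
  have e1 : (G * ((ρ - S * L * S) * G * (ρ - S * L * S))).trace =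
      (G * ρ * G * ρ).trace - 2 * (L * ρ).trace + (L * S * L * S).trace := by
    have : G * ((ρ - S * L * S) * G * (ρ - S * L * S)) =
        G * ρ * G * ρ - G * ρ * (G * S) * L * S - (G * S) * L * (S * G) * ρ
          + (G * S) * L * (S * G) * S * L * S := by
      noncomm_ring
    rw [this, hGS, hSG]
    have c1 : (G * ρ * L * S).trace = (L * ρ).trace := by
      rw [Matrix.trace_mul_comm, ← Matrix.mul_assoc, ← Matrix.mul_assoc, hSG,
        Matrix.one_mul, Matrix.trace_mul_comm]
    simp only [Matrix.trace_add, Matrix.trace_sub, Matrix.one_mul, Matrix.mul_one, c1]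
    ring
  have e2 : ((L * S - S * L)ᴴ * (L * S - S * L)).trace =
      2 * (L * L * (S * S)).trace - 2 * (L * S * L * S).trace := by
    have : (L * S - S * L)ᴴ * (L * S - S * L) =
        S * (L * L * S) - S * L * S * L - (L * S * L * S) + L * (S * S * L) := by
      simp only [conjTranspose_sub, conjTranspose_mul, hS.eq, hL.eq]
      noncomm_ring
    rw [this]
    have c1 : (S * (L * L * S)).trace = (L * L * (S * S)).trace := by
      rw [Matrix.trace_mul_comm, Matrix.mul_assoc (L * L)]
    have c2 : (L * (S * S * L)).trace = (L * L * (S * S)).trace := by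
      rw [Matrix.trace_mul_comm, Matrix.mul_assoc, Matrix.trace_mul_comm]
    have c3 : (S * L * S * L).trace = (L * S * L * S).trace := by
      rw [Matrix.trace_mul_comm]; simp only [Matrix.mul_assoc]
    simp only [Matrix.trace_add, Matrix.trace_sub, c1, c2, c3]
    ring
  rw [e1] at h1
  rw [e2] at h2
  rw [Matrix.sub_mul, Matrix.trace_sub] at h3
  simp only [Complex.add_re, Complex.sub_re, Complex.mul_re, Complex.re_ofNat, Complex.im_ofNat,
    zero_mul, sub_zero] at h1 h2 h3
  linarith

/-- A measurement that identifies each `ρ j` as well as a classical union bound over the tests `L j`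
would give, up to an arbitrarily small loss. -/
theorem exists_measurement [DecidableEq J] [Nonempty J] (ρ L : J → Matrix A A ℂ)
    (hρ : ∀ j, (ρ j).PosSemidef) (hL : ∀ j, (L j).PosSemidef)
    (hLL : ∀ j, (L j - L j * L j).PosSemidef) {s : ℝ} (hs : 0 < s) :
    ∃ M : J → Matrix A A ℂ, (∀ j, (M j).PosSemidef) ∧ ∑ j, M j = 1 ∧
      ∀ j, 2 * ((L j * ρ j).trace).re - ((L j * ∑ i, ρ i).trace).re - s ≤
        ((M j * ρ j).trace).re := by
  obtain ⟨j₀⟩ := ‹Nonempty J›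
  have hLt : ∀ j, 0 ≤ (L j).trace.re := fun j => re_trace_nonneg (hL j)
  obtain ⟨t, ht, hts⟩ : ∃ t : ℝ, 0 < t ∧ ∀ j, t * (L j).trace.re ≤ s := by
    have h0 : 0 ≤ ∑ j, (L j).trace.re := Finset.sum_nonneg fun j _ => hLt j
    refine ⟨s / (∑ j, (L j).trace.re + 1), by positivity, fun j => ?_⟩
    rw [div_mul_eq_mul_div, div_le_iff₀ (by positivity)]
    have := Finset.single_le_sum (fun j _ => hLt j) (Finset.mem_univ j)
    nlinarith
  -- Adding t · 1 makes the sum of the `ρ j` invertible, so that no supports have to be tracked; it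
  -- costs t Tr(L j) ≤ s.
  have h1 : (((t : ℂ)) • (1 : Matrix A A ℂ)).PosDef := PosDef.one.smul (by simpa using ht)
  have hQ : (∑ i, ρ i + (t : ℂ) • (1 : Matrix A A ℂ)).PosDef :=
    h1.posSemidef_add (posSemidef_sum _ fun j _ => hρ j)
  obtain ⟨S, G, hS, hG, hSS, hcomm, hSGS⟩ := exists_sqrt_pinv hQ.posSemidef
  have hSu : IsUnit S := by
    have := hQ.isUnit
    rw [← hSS] at this
    exact isUnit_of_mul_isUnit_left this
  have hSG : S * G = 1 := hSu.mul_right_cancel (by rw [hSGS, Matrix.one_mul])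
  have hGS : G * S = 1 := by rw [← hcomm, hSG]
  have hGρ : ∀ X : Matrix A A ℂ, X.PosSemidef → (G * X * G).PosSemidef := fun X hX => by
    have h := hX.mul_mul_conjTranspose_same G
    rwa [hG.1.eq] at h
  have hrest := hGρ _ h1.posSemidef
  -- The part of the identity due to t · 1 is assigned to an arbitrary outcome `j₀`, where it can
  -- only increase the success probability.
  refine ⟨fun j => G * ρ j * G + if j = j₀ then G * ((t : ℂ) • (1 : Matrix A A ℂ)) * G else 0,
    fun j => (hGρ _ (hρ j)).add ?_, ?_, fun j => ?_⟩
  · split_ifs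
    · exact hrest
    · exact PosSemidef.zero
  · rw [Finset.sum_add_distrib, Finset.sum_ite_eq' Finset.univ j₀, if_pos (Finset.mem_univ _),
      ← Matrix.sum_mul, ← Matrix.mul_sum, ← Matrix.add_mul, ← Matrix.mul_add, ← hSS,
      ← Matrix.mul_assoc, hGS, Matrix.one_mul, hSG]
  · have h := pretty_good_success hS.1 hG hGS hSG (hρ j).1 (hL j).1 (hLL j)
    have h' : 0 ≤ (((if j = j₀ then G * ((t : ℂ) • (1 : Matrix A A ℂ)) * G else 0) *
        ρ j).trace).re := by
      split_ifs
      · exact re_trace_mul_nonneg hrest (hρ j)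
      · simp
    rw [hSS, Matrix.mul_add, Matrix.trace_add, Matrix.mul_smul, Matrix.mul_one,
      Matrix.trace_smul] at h
    rw [Matrix.add_mul, Matrix.trace_add]
    simp only [Complex.add_re, smul_eq_mul, Complex.re_ofReal_mul] at h ⊢
    linarith [hts j]

/-- Every measurement is implemented by a channel. -/
theorem exists_channel_of_measurement [DecidableEq J] (M : J → Matrix A A ℂ)
    (hM : ∀ j, (M j).PosSemidef) (hsum : ∑ j, M j = 1) :
    ∃ D : Matrix A A ℂ →ₗ[ℂ] Matrix J J ℂ, IsChannel D ∧ ∀ X j, D X j j = (M j * X).trace := by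
  choose R hR using fun j => exists_eq_conjTranspose_mul_self (hM j)
  -- The Kraus operators are |j⟩⟨i| R_j: outcome j is recorded and the post-measurement index i is
  -- forgotten.
  let K : J × A → Matrix J A ℂ := fun i => Matrix.of fun j a => if j = i.1 then R i.1 i.2 a else 0
  refine ⟨krausMap K, isChannel_krausMap K ?_, fun X j => ?_⟩
  · rw [← hsum]
    ext a a'
    simp [K, hR, Matrix.sum_apply, Matrix.mul_apply, Fintype.sum_prod_type,
      apply_ite (starRingEnd ℂ)]
  · rw [krausMap_apply, hR, Matrix.mul_assoc, Matrix.trace_mul_comm]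
    simp [K, Matrix.sum_apply, Matrix.mul_apply, Fintype.sum_prod_type, Matrix.trace,
      apply_ite (starRingEnd ℂ)]

theorem posSemidef_sub_mul_self {L : Matrix A A ℂ} (hL : L.PosSemidef)
    (hL' : (1 - L).PosSemidef) : (L - L * L).PosSemidef := by
  have h1 := hL'.mul_mul_conjTranspose_same L
  have h2 := hL.mul_mul_conjTranspose_same (1 - L)
  rw [hL.1.eq] at h1
  rw [hL'.1.eq] at h2
  have : L - L * L = L * (1 - L) * L + (1 - L) * L * (1 - L) := by noncomm_ring
  rw [this]
  exact h1.add h2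

end PrettyGood

/-! ### Preparing a state from the purification of its marginal -/

section Marginal

variable {A R : Type*} [Fintype A] [Fintype R] [DecidableEq R]

/-- A channel that prepares `ψ` from the canonical purification of its marginal, the latter being
given by a square root `S` of the marginal with the pseudoinverse `G`. -/
theorem exists_channel_of_marginal [Nonempty A] {ψ : Matrix (A × R) (A × R) ℂ} (hψ : ψ.PosSemidef)
    {S G : Matrix R R ℂ} (hS : S.IsHermitian)
    (hG : G.IsHermitian) (hSS : S * S = trLeft ψ) (hcomm : S * G = G * S) (hSGS : S * G * S = S) :
    ∃ V : Matrix R R ℂ →ₗ[ℂ] Matrix A A ℂ, IsChannel V ∧ ∀ r r' a a',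
      V (Matrix.of fun e e' => S r e * star (S r' e')) a a' = ψ (a, r) (a', r') := by
  classical
  obtain ⟨a₀⟩ := ‹Nonempty A›
  obtain ⟨B, rfl⟩ := exists_eq_conjTranspose_mul_self hψ
  -- `C` is the coefficient matrix of a purification of ψ with environment `A × R`. It and `Sᵀ`
  -- purify the same marginal, hence `Cᴴ * C = Sᵀ * Sᵀ`, and `C * Gᵀ` is the partial isometry of the
  -- polar decomposition of `C`.
  let C : Matrix ((A × R) × A) R ℂ := Matrix.of fun i r => star (B i.1 (i.2, r))
  have hSt : (Sᵀ)ᴴ = Sᵀ := hS.transpose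
  have hGt : (Gᵀ)ᴴ = Gᵀ := hG.transpose
  have hcommt : Sᵀ * Gᵀ = Gᵀ * Sᵀ := by rw [← transpose_mul, ← transpose_mul, hcomm]
  have hSGSt : Sᵀ * Gᵀ * Sᵀ = Sᵀ := by
    rw [← transpose_mul, ← transpose_mul, ← Matrix.mul_assoc, hSGS]
  have hCC : Cᴴ * C = Sᵀ * Sᵀ := by
    rw [← transpose_mul, hSS]
    ext r r'
    simp [C, trLeft, Matrix.mul_apply, Fintype.sum_prod_type_right, mul_comm]
  -- The projection onto the kernel of `Sᵀ`, where the partial isometry vanishes.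
  let T : Matrix R R ℂ := 1 - Gᵀ * Sᵀ
  have hT : Tᴴ = T := by simp [T, hSt, hGt, hcommt]
  have hTS : T * Sᵀ = 0 := by
    rw [Matrix.sub_mul, ← hcommt, hSGSt, Matrix.one_mul, sub_self]
  have hST : Sᵀ * T = 0 := by
    rw [Matrix.mul_sub, ← Matrix.mul_assoc, hSGSt, Matrix.mul_one, sub_self]
  have hTT : T * T = T := by
    nth_rewrite 2 [show T = 1 - Gᵀ * Sᵀ from rfl]
    rw [← hcommt, Matrix.mul_sub, ← Matrix.mul_assoc, hTS, Matrix.zero_mul, sub_zero,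
      Matrix.mul_one]
  have hCT : C * T = 0 := by
    rw [← Matrix.conjTranspose_mul_self_eq_zero, conjTranspose_mul, Matrix.mul_assoc,
      ← Matrix.mul_assoc Cᴴ, hCC, Matrix.mul_assoc Sᵀ, hST, Matrix.mul_zero, Matrix.mul_zero]
  have hCGS : C * Gᵀ * Sᵀ = C := by
    have : C * T = C - C * Gᵀ * Sᵀ := by simp [T, Matrix.mul_sub, Matrix.mul_assoc]
    rw [hCT] at this
    exact (sub_eq_zero.mp this.symm).symm
  obtain ⟨D, hD⟩ : ∃ D, D = C * Gᵀ := ⟨_, rfl⟩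
  -- The first family applies the partial isometry and traces out the environment. The second sends
  -- the kernel of `Sᵀ` to `a₀`; it restores trace preservation and is never triggered on the
  -- purification.
  let K : (A × R) ⊕ R → Matrix A R ℂ := Sum.elim
    (fun i => Matrix.of fun a e => D (i, a) e)
    (fun i => Matrix.of fun a e => if a = a₀ then T i e else 0)
  refine ⟨krausMap K, isChannel_krausMap K ?_, fun r r' a a' => ?_⟩
  · have h1 : ∑ i, (K i)ᴴ * K i = Dᴴ * D + Tᴴ * T := by
      ext e e'
      simp [K, Matrix.sum_apply, Matrix.mul_apply, Fintype.sum_prod_type,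
        apply_ite (starRingEnd ℂ)]
    rw [h1, hD, conjTranspose_mul, Matrix.mul_assoc, ← Matrix.mul_assoc Cᴴ, hCC, hT, hTT, hGt,
      Matrix.mul_assoc Sᵀ, hcommt, ← Matrix.mul_assoc Sᵀ, hSGSt]
    simp [T]
  · have h1 : (Matrix.of fun e e' => S r e * star (S r' e')) =
        vecMulVec (S r) (star (S r')) := rfl
    have h2 : ∀ r i, K i *ᵥ S r = fun a => Sum.elim (fun i => C (i, a) r) (fun _ => 0) i := by
      rintro r (i | i)
      · ext a
        have := congrFun (congrFun hCGS (i, a)) r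
        rw [← hD] at this
        simpa [Matrix.mul_apply, K, mulVec, dotProduct] using this
      · ext a
        have := congrFun (congrFun hTS i) r
        simp only [Matrix.mul_apply, transpose_apply, Matrix.zero_apply] at this
        by_cases ha : a = a₀ <;> simp [K, mulVec, dotProduct, ha, this]
    rw [krausMap_apply, h1]
    simp only [mul_vecMulVec, vecMulVec_mul, ← star_mulVec, h2]
    simp [Matrix.sum_apply, vecMulVec_apply, C, Matrix.mul_apply]

end Marginal

/-! ### Operators placed on one of several copies -/

section Placed

variable {B J R : Type*} [Fintype J] [DecidableEq J]

/-- Distributivity of products over sums, with the factor at `m` singled out; all partial traces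
over the copies reduce to it. -/
theorem sum_mul_prod_erase [Fintype R] (m : J) (F : R → ℂ) (g : J → R → ℂ) :
    ∑ f : J → R, F (f m) * ∏ i ∈ Finset.univ.erase m, g i (f i) =
      (∑ r, F r) * ∏ i ∈ Finset.univ.erase m, ∑ r, g i r := by
  have h : ∀ i ∈ Finset.univ.erase m, Function.update g m F i = g i := fun i hi =>
    Function.update_of_ne (Finset.ne_of_mem_erase hi) _ _
  have h1 : ∀ f : J → R, F (f m) * ∏ i ∈ Finset.univ.erase m, g i (f i) =
      ∏ i, Function.update g m F i (f i) := fun f => by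
    rw [← Finset.mul_prod_erase _ _ (Finset.mem_univ m), Function.update_self]
    exact congrArg _ (Finset.prod_congr rfl fun i hi => by rw [h i hi])
  simp only [h1]
  rw [← Fintype.piFinset_univ, ← Finset.prod_univ_sum,
    ← Finset.mul_prod_erase _ _ (Finset.mem_univ m), Function.update_self]
  exact congrArg _ (Finset.prod_congr rfl fun i hi => by rw [h i hi])

/-- The operator on `B` and copies of `R` that acts as `τ` on `B` and the copy number `m`, and as
`ω` on each of the other copies. -/
def placed (τ : Matrix (B × R) (B × R) ℂ) (ω : Matrix R R ℂ) (m : J) :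
    Matrix (B × (J → R)) (B × (J → R)) ℂ :=
  Matrix.of fun x y => τ (x.1, x.2 m) (y.1, y.2 m) *
    ∏ i ∈ Finset.univ.erase m, ω (x.2 i) (y.2 i)

variable {τ τ' : Matrix (B × R) (B × R) ℂ} {ω ω' : Matrix R R ℂ} {m : J}

theorem placed_sub : placed (τ - τ') ω m = placed τ ω m - placed τ' ω m := by
  ext x y
  simp [placed, sub_mul]

theorem placed_one [DecidableEq B] [DecidableEq R] :
    placed (1 : Matrix (B × R) (B × R) ℂ) 1 m = 1 := by
  ext ⟨b, f⟩ ⟨b', f'⟩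
  by_cases h : f = f'
  · subst h
    simp [placed, Matrix.one_apply]
  · obtain ⟨i, hi⟩ := Function.ne_iff.mp h
    by_cases him : i = m
    · subst him
      simp [placed, Matrix.one_apply, hi, h]
    · have : ∏ i ∈ Finset.univ.erase m, (1 : Matrix R R ℂ) (f i) (f' i) = 0 :=
        Finset.prod_eq_zero (Finset.mem_erase.mpr ⟨him, Finset.mem_univ i⟩) (by simp [hi])
      simp [placed, this, h]

theorem conjTranspose_placed : (placed τ ω m)ᴴ = placed τᴴ ωᴴ m := by
  ext x y
  simp [placed]

theorem placed_mul_placed [Fintype B] [Fintype R] :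
    placed τ ω m * placed τ' ω' m = placed (τ * τ') (ω * ω') m := by
  ext x y
  have h : ∀ b, ∑ f : J → R, placed τ ω m x (b, f) * placed τ' ω' m (b, f) y =
      (∑ r, τ (x.1, x.2 m) (b, r) * τ' (b, r) (y.1, y.2 m)) *
        ∏ i ∈ Finset.univ.erase m, (ω * ω') (x.2 i) (y.2 i) := fun b => by
    have := sum_mul_prod_erase m (fun r => τ (x.1, x.2 m) (b, r) * τ' (b, r) (y.1, y.2 m))
      (fun i r => ω (x.2 i) r * ω' r (y.2 i))
    simp only [Matrix.mul_apply, ← this, Finset.prod_mul_distrib]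
    exact Finset.sum_congr rfl fun f _ => by simp only [placed, Matrix.of_apply]; ring
  rw [Matrix.mul_apply, Fintype.sum_prod_type]
  simp only [h, ← Finset.sum_mul]
  simp only [placed, Matrix.of_apply, Matrix.mul_apply (M := τ), Fintype.sum_prod_type]

theorem posSemidef_placed [Fintype B] [Fintype R] (hτ : τ.PosSemidef) (hω : ω.PosSemidef) :
    (placed τ ω m).PosSemidef := by
  obtain ⟨S, rfl⟩ := exists_eq_conjTranspose_mul_self hτ
  obtain ⟨T, rfl⟩ := exists_eq_conjTranspose_mul_self hω
  rw [← placed_mul_placed, ← conjTranspose_placed]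
  exact posSemidef_conjTranspose_mul_self _

theorem trace_placed [Fintype B] [Fintype R] (hω : ω.trace = 1) :
    (placed τ ω m).trace = τ.trace := by
  have h : ∀ b, ∑ f : J → R, placed τ ω m (b, f) (b, f) = ∑ r, τ (b, r) (b, r) := fun b => by
    have := sum_mul_prod_erase m (fun r => τ (b, r) (b, r)) (fun _ r => ω r r)
    rw [show ∑ r, ω r r = 1 from hω, Finset.prod_const_one, mul_one] at this
    exact this
  simp only [Matrix.trace, Matrix.diag, Fintype.sum_prod_type, h]

theorem trace_placed_one_mul_placed_self [Fintype B] [Fintype R] [DecidableEq R]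
    (hω : ω.trace = 1) (L : Matrix (B × R) (B × R) ℂ) :
    (placed L 1 m * placed τ ω m).trace = (L * τ).trace := by
  rw [placed_mul_placed, Matrix.one_mul, trace_placed hω]

/-- A test on the wrong copy: `B` is correlated with copy `j` only, so `B` and copy `m` are jointly
in the product of the marginals. -/
theorem trace_placed_one_mul_placed [Fintype B] [Fintype R] [DecidableEq R]
    (hω : ω.trace = 1) (L : Matrix (B × R) (B × R) ℂ) {j : J} (hj : j ≠ m) :
    (placed L 1 m * placed τ ω j).trace = (L * (trRight τ ⊗ₖ ω)).trace := by
  have hmj : m ∈ Finset.univ.erase j := Finset.mem_erase.mpr ⟨hj.symm, Finset.mem_univ m⟩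
  -- The inner sum is factored at copy `m`, the outer one at copy `j`; the conditionals carry the
  -- factor of the other special copy inside the product.
  have h1 : ∀ b b' (f : J → R), ∑ f' : J → R, placed L 1 m (b, f) (b', f') *
      placed τ ω j (b', f') (b, f) = τ (b', f j) (b, f j) *
        ∏ i ∈ Finset.univ.erase j, if i = m then ∑ r, L (b, f i) (b', r) * ω r (f i) else
          ω (f i) (f i) := fun b b' f => by
    have e1 : ∀ f' : J → R, placed L 1 m (b, f) (b', f') * placed τ ω j (b', f') (b, f) =
        (L (b, f m) (b', f' m) * ω (f' m) (f m)) * ∏ i ∈ Finset.univ.erase m,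
          ((1 : Matrix R R ℂ) (f i) (f' i) *
            if i = j then τ (b', f' i) (b, f i) else ω (f' i) (f i)) := fun f' => by
      have e := Finset.mul_prod_erase Finset.univ
        (fun i => if i = j then τ (b', f' i) (b, f i) else ω (f' i) (f i)) (Finset.mem_univ m)
      rw [← Finset.mul_prod_erase Finset.univ _ (Finset.mem_univ j), if_neg hj.symm, if_pos rfl,
        Finset.prod_congr (g := fun i => ω (f' i) (f i)) rfl
          fun i hi => if_neg (Finset.ne_of_mem_erase hi)] at e
      simp only [placed, Matrix.of_apply, Finset.prod_mul_distrib]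
      rw [← e]
      ring
    have e2 := Finset.mul_prod_erase Finset.univ
      (fun i => if i = j then τ (b', f i) (b, f i) else
        if i = m then ∑ r, L (b, f i) (b', r) * ω r (f i) else ω (f i) (f i)) (Finset.mem_univ m)
    rw [← Finset.mul_prod_erase Finset.univ _ (Finset.mem_univ j), if_neg hj.symm, if_pos rfl,
      if_pos rfl, Finset.prod_congr (s₂ := Finset.univ.erase j) rfl
        fun i hi => if_neg (Finset.ne_of_mem_erase hi)] at e2
    simp only [e1]
    rw [← e2, sum_mul_prod_erase m (fun r => L (b, f m) (b', r) * ω r (f m))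
      (fun i r => (1 : Matrix R R ℂ) (f i) r * if i = j then τ (b', r) (b, f i) else ω r (f i))]
    refine congrArg _ (Finset.prod_congr rfl fun i hi => ?_)
    simp [Matrix.one_apply, Finset.ne_of_mem_erase hi]
  have h2 : ∀ b b', ∑ f : J → R, ∑ f' : J → R, placed L 1 m (b, f) (b', f') *
      placed τ ω j (b', f') (b, f) = (trRight τ) b' b * ∑ r, ∑ r', L (b, r) (b', r') * ω r' r :=
    fun b b' => by
    simp only [h1]
    rw [sum_mul_prod_erase j (fun r => τ (b', r) (b, r))
      (fun i r => if i = m then ∑ r', L (b, r) (b', r') * ω r' r else ω r r),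
      Finset.prod_eq_single_of_mem m hmj fun i _ hi => by
        simpa [hi, Matrix.trace, Matrix.diag] using hω]
    simp [trRight]
  have h3 : (placed L 1 m * placed τ ω j).trace = ∑ b, ∑ b', ∑ f : J → R, ∑ f' : J → R,
      placed L 1 m (b, f) (b', f') * placed τ ω j (b', f') (b, f) := by
    simp only [Matrix.trace, Matrix.diag, Matrix.mul_apply, Fintype.sum_prod_type]
    exact Finset.sum_congr rfl fun b _ => Finset.sum_comm
  have h4 : (L * (trRight τ ⊗ₖ ω)).trace = ∑ b, ∑ b', ∑ r, ∑ r', L (b, r) (b', r') *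
      ((trRight τ) b' b * ω r' r) := by
    simp only [Matrix.trace, Matrix.diag, Matrix.mul_apply, Fintype.sum_prod_type,
      kroneckerMap_apply]
    exact Finset.sum_congr rfl fun b _ => Finset.sum_comm
  rw [h3, h4]
  simp only [h2, Finset.mul_sum]
  refine Finset.sum_congr rfl fun b _ => Finset.sum_congr rfl fun b' _ =>
    Finset.sum_congr rfl fun r _ => Finset.sum_congr rfl fun r' _ => by ring

end Placed

/-! ### Position-based decoding -/

section Decoder

variable {B R : Type*} [Fintype B] [Fintype R] [DecidableEq B] [DecidableEq R]

/-- Position based decoding of one out of `k` messages by means of a test. -/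
theorem exists_decoder_of_test {k : ℕ} [NeZero k] {τ : Matrix (B × R) (B × R) ℂ}
    {ω : Matrix R R ℂ} (hτ : IsState τ) (hω : IsState ω) {ε : ℝ} {L : Matrix (B × R) (B × R) ℂ}
    (hL : IsTest ε τ L) {s : ℝ} (hs : 0 < s) :
    ∃ D : Matrix (B × (Fin k → R)) (B × (Fin k → R)) ℂ →ₗ[ℂ] Matrix (Fin k) (Fin k) ℂ,
      IsChannel D ∧ ∀ m, ∑ j ∈ Finset.univ.erase m, (D (placed τ ω m) j j).re ≤
        ε + k * ((L * (trRight τ ⊗ₖ ω)).trace).re + s := by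
  obtain ⟨hL0, hL1, hLε⟩ := hL
  have hp : ∀ j : Fin k, (placed L 1 j).PosSemidef := fun j =>
    posSemidef_placed hL0 PosSemidef.one
  have hp' : ∀ j : Fin k, (placed L 1 j - placed L 1 j * placed L 1 j).PosSemidef := fun j => by
    refine posSemidef_sub_mul_self (hp j) ?_
    rw [← placed_one (m := j), ← placed_sub]
    exact posSemidef_placed hL1 PosSemidef.one
  obtain ⟨M, hM, hM1, hMs⟩ := exists_measurement (fun j : Fin k => placed τ ω j)
    (fun j => placed L 1 j) (fun j => posSemidef_placed hτ.1 hω.1) hp hp' hs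
  obtain ⟨D, hD, hDM⟩ := exists_channel_of_measurement M hM hM1
  refine ⟨D, hD, fun m => ?_⟩
  have htot : ∑ j, (D (placed τ ω m) j j).re = 1 := by
    have h := hD.trace_preserving (placed τ ω m)
    rw [trace_placed hω.2, hτ.2] at h
    rw [← Complex.re_sum]
    exact (congrArg Complex.re h).trans Complex.one_re
  have hm := hMs m
  -- In the sum over all messages the term of `m` itself cancels one of the two Tr(Lτ), and the
  -- remaining k - 1 terms are all equal to Tr(Lσ).
  rw [← hDM, Matrix.mul_sum, Matrix.trace_sum, Complex.re_sum,
    ← Finset.add_sum_erase _ _ (Finset.mem_univ m), trace_placed_one_mul_placed_self hω.2,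
    Finset.sum_congr (g := fun _ => ((L * (trRight τ ⊗ₖ ω)).trace).re) rfl fun j hj => by
      rw [trace_placed_one_mul_placed hω.2 L (Finset.ne_of_mem_erase hj)],
    Finset.sum_const, Finset.card_erase_of_mem (Finset.mem_univ m), Finset.card_univ,
    Fintype.card_fin, nsmul_eq_mul, Nat.cast_pred (Nat.pos_of_neZero k)] at hm
  have hσ : 0 ≤ ((L * (trRight τ ⊗ₖ ω)).trace).re :=
    re_trace_mul_nonneg hL0 ((posSemidef_trRight hτ.1).kronecker hω.1)
  rw [← Finset.add_sum_erase _ _ (Finset.mem_univ m)] at htot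
  linarith

/-- As δ ≤ ε, the subtracted logarithm strictly exceeds log(2/δ). The strict gap supplies a good
enough test even if the supremum is not attained. -/
theorem exists_test_of_le_DH {A : Type*} [Fintype A] [DecidableEq A] {ρ σ : Matrix A A ℂ}
    (hσ : σ.PosSemidef) {ε δ r : ℝ} (hδ : 0 < δ) (hδε : δ ≤ ε)
    (h : (r : EReal) ≤ DH ε ρ σ - ((Real.logb 2 (4 * ε / δ ^ 2) : ℝ) : EReal)) :
    ∃ L, IsTest ε ρ L ∧ (2 : ℝ) ^ r * ((L * σ).trace).re ≤ δ / 2 := by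
  have hlog : Real.logb 2 (2 / δ) < Real.logb 2 (4 * ε / δ ^ 2) := by
    refine Real.logb_lt_logb one_lt_two (by positivity) ?_
    rw [div_lt_div_iff₀ hδ (by positivity)]
    nlinarith [mul_pos hδ hδ]
  have hlt : ((r + Real.logb 2 (2 / δ) : ℝ) : EReal) < DH ε ρ σ := by
    rw [EReal.le_sub_iff_add_le (by simp) (by simp), ← EReal.coe_add] at h
    exact lt_of_lt_of_le (EReal.coe_lt_coe_iff.mpr (by linarith)) h
  obtain ⟨L, hL⟩ := lt_iSup_iff.mp hlt
  obtain ⟨hT, hL⟩ := lt_iSup_iff.mp hL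
  refine ⟨L, hT, ?_⟩
  have h0 : 0 ≤ ((L * σ).trace).re := re_trace_mul_nonneg hT.1 hσ
  rcases h0.eq_or_lt with h0 | h0
  -- Here `logInv` is `⊤` and carries no real bound, but the claim is trivial.
  · rw [← h0]
    simp only [mul_zero]
    positivity
  · rw [logInv, if_neg h0.ne', EReal.coe_lt_coe_iff,
      Real.lt_logb_iff_rpow_lt one_lt_two (by positivity), Real.rpow_add two_pos,
      Real.rpow_logb two_pos (by norm_num) (by positivity), lt_div_iff₀ h0] at hL
    have : (2 : ℝ) ^ r * ((L * σ).trace).re =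
        2 ^ r * (2 / δ) * ((L * σ).trace).re * (δ / 2) := by
      field_simp
    rw [this]
    nlinarith

theorem exists_decoder {τ : Matrix (B × R) (B × R) ℂ} {ω : Matrix R R ℂ} (hτ : IsState τ)
    (hω : IsState ω) {ε δ r : ℝ} (hδ : 0 < δ) (hδε : δ ≤ ε) (hr : 0 ≤ r)
    (h : (r : EReal) ≤ DH ε τ (trRight τ ⊗ₖ ω) - ((Real.logb 2 (4 * ε / δ ^ 2) : ℝ) : EReal)) :
    ∃ D : Matrix (B × (Fin ⌊(2 : ℝ) ^ r⌋₊ → R)) (B × (Fin ⌊(2 : ℝ) ^ r⌋₊ → R)) ℂ →ₗ[ℂ]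
        Matrix (Fin ⌊(2 : ℝ) ^ r⌋₊) (Fin ⌊(2 : ℝ) ^ r⌋₊) ℂ,
      IsChannel D ∧ ∀ m, ∑ j ∈ Finset.univ.erase m, (D (placed τ ω m) j j).re ≤ ε + δ := by
  have hσ : (trRight τ ⊗ₖ ω).PosSemidef := (posSemidef_trRight hτ.1).kronecker hω.1
  obtain ⟨L, hL, hLσ⟩ := exists_test_of_le_DH hσ hδ hδε h
  -- A nonnegative rate gives at least one message, hence a measurement with at least one outcome.
  have hk : NeZero ⌊(2 : ℝ) ^ r⌋₊ :=
    ⟨(Nat.floor_pos.mpr (Real.one_le_rpow one_le_two hr)).ne'⟩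
  -- One δ/2 pays for the regularisation of the measurement, the other for the wrong copies.
  obtain ⟨D, hD, hDe⟩ := exists_decoder_of_test (k := ⌊(2 : ℝ) ^ r⌋₊) hτ hω hL (half_pos hδ)
  refine ⟨D, hD, fun m => (hDe m).trans ?_⟩
  have h1 : (⌊(2 : ℝ) ^ r⌋₊ : ℝ) ≤ 2 ^ r := Nat.floor_le (by positivity)
  have h2 := mul_le_mul_of_nonneg_right h1 (re_trace_mul_nonneg hL.1 hσ)
  linarith

end Decoder

/-! ### Shared copies and Alice's encoder -/

section Encoder

variable {A E E₁ E₂ J : Type*}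

/-- Product vectors: `n` copies of the bipartite vector with the coefficient matrix `Sᵀ`. -/
def copies [Fintype J] (S : Matrix E E ℂ) : (J → E) × (J → E) → ℂ :=
  fun x => ∏ i, S (x.2 i) (x.1 i)

theorem isKet_copies [Fintype J] [Fintype E] [DecidableEq J] {S : Matrix E E ℂ}
    (hS : (S * Sᴴ).trace = 1) : IsKet (copies S : (J → E) × (J → E) → ℂ) := by
  have h1 : ∑ p : E × E, ‖S p.2 p.1‖ ^ 2 = 1 := by
    have h : (S * Sᴴ).trace = ((∑ p : E × E, ‖S p.2 p.1‖ ^ 2 : ℝ) : ℂ) := by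
      rw [Fintype.sum_prod_type_right]
      simp [Matrix.trace, Matrix.mul_apply, Complex.mul_conj']
    rw [hS] at h
    exact_mod_cast h.symm
  have h2 : ∑ p : J → E × E, ∏ i, ‖S (p i).2 (p i).1‖ ^ 2 = 1 := by
    rw [← Fintype.piFinset_univ,
      ← Finset.prod_univ_sum (fun _ : J => (Finset.univ : Finset (E × E))) (fun _ p => ‖S p.2 p.1‖ ^ 2),
      h1, Finset.prod_const_one]
  rw [IsKet, ← h2, ← (Equiv.arrowProdEquivProdArrow J (fun _ => E) (fun _ => E)).sum_comp]
  simp [copies, Finset.prod_pow]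

/-- Alice's encoder: it reads the messages, picks the corresponding copies and applies `V` to
them. -/
theorem exists_encoder {k₁ k₂ : ℕ} [Fintype A] [Fintype E₁] [Fintype E₂]
    {V : Matrix (E₁ × E₂) (E₁ × E₂) ℂ →ₗ[ℂ] Matrix A A ℂ} (hV : IsChannel V) :
    ∃ enc : Matrix ((Fin k₁ × Fin k₂) × ((Fin k₁ → E₁) × (Fin k₂ → E₂)))
        ((Fin k₁ × Fin k₂) × ((Fin k₁ → E₁) × (Fin k₂ → E₂))) ℂ →ₗ[ℂ] Matrix A A ℂ,
      IsChannel enc ∧ ∀ (X : Matrix ((Fin k₁ × Fin k₂) × ((Fin k₁ → E₁) × (Fin k₂ → E₂)))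
        ((Fin k₁ × Fin k₂) × ((Fin k₁ → E₁) × (Fin k₂ → E₂))) ℂ), enc X =
        ∑ m : Fin k₁ × Fin k₂, ∑ g₁ : {i // i ≠ m.1} → E₁, ∑ g₂ : {i // i ≠ m.2} → E₂,
          V (Matrix.of fun c c' =>
            X (m, ((Equiv.funSplitAt m.1 E₁).symm (c.1, g₁),
                (Equiv.funSplitAt m.2 E₂).symm (c.2, g₂)))
              (m, ((Equiv.funSplitAt m.1 E₁).symm (c'.1, g₁),
                (Equiv.funSplitAt m.2 E₂).symm (c'.2, g₂)))) := by
  let s : (m : Fin k₁ × Fin k₂) → ({i // i ≠ m.1} → E₁) → ({i // i ≠ m.2} → E₂) → E₁ × E₂ →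
      (Fin k₁ × Fin k₂) × ((Fin k₁ → E₁) × (Fin k₂ → E₂)) := fun m g₁ g₂ c =>
    (m, ((Equiv.funSplitAt m.1 E₁).symm (c.1, g₁), (Equiv.funSplitAt m.2 E₂).symm (c.2, g₂)))
  -- The sum over `m` measures the message registers; the sums over `g₁` and `g₂` trace out the
  -- copies that were not selected.
  let enc := ∑ m, ∑ g₁, ∑ g₂, V ∘ₗ submatrixMap (s m g₁ g₂)
  have henc : ∀ X, enc X = ∑ m, ∑ g₁, ∑ g₂, V (X.submatrix (s m g₁ g₂) (s m g₁ g₂)) := fun X => by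
    simp [enc, submatrixMap_apply]
  refine ⟨enc, ⟨?_, fun X => ?_⟩, henc⟩
  · exact IsCP.sum fun m _ => IsCP.sum fun g₁ _ => IsCP.sum fun g₂ _ =>
      IsCP.comp hV.completely_positive (isCP_submatrixMap _)
  · rw [henc]
    simp only [Matrix.trace_sum, hV.trace_preserving]
    simp only [Matrix.trace, Matrix.diag]
    rw [Fintype.sum_prod_type (f := fun x : (Fin k₁ × Fin k₂) ×
      ((Fin k₁ → E₁) × (Fin k₂ → E₂)) => X x x)]
    refine Finset.sum_congr rfl fun m _ => ?_
    rw [Fintype.sum_prod_type, ← (Equiv.funSplitAt m.1 E₁).symm.sum_comp,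
      Fintype.sum_prod_type_right]
    refine Finset.sum_congr rfl fun g₁ _ => ?_
    have : ∀ x : E₁, ∑ y : Fin k₂ → E₂, X (m, ((Equiv.funSplitAt m.1 E₁).symm (x, g₁), y))
        (m, ((Equiv.funSplitAt m.1 E₁).symm (x, g₁), y)) = ∑ g₂, ∑ c₂,
        X (s m g₁ g₂ (x, c₂)) (s m g₁ g₂ (x, c₂)) := fun x => by
      rw [← (Equiv.funSplitAt m.2 E₂).symm.sum_comp, Fintype.sum_prod_type_right]
    simp only [this]
    refine (Finset.sum_comm.trans ?_).symm
    exact Finset.sum_congr rfl fun g₂ _ => (Fintype.sum_prod_type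
      fun c => X (s m g₁ g₂ c) (s m g₁ g₂ c)).symm

theorem prod_funSplitAt [Fintype J] [DecidableEq J] (m : J) (h : J → E → ℂ) (c : E)
    (g : {i // i ≠ m} → E) :
    ∏ i, h i ((Equiv.funSplitAt m E).symm (c, g) i) = h m c * ∏ i : {i // i ≠ m}, h i (g i) := by
  rw [Fintype.prod_eq_mul_prod_subtype_ne _ m]
  congr 1
  · simp
  · exact Finset.prod_congr rfl fun i _ => by simp [i.2]

/-- Discarding Alice's halves of the unselected copies leaves the receiver with their marginals. -/
theorem sum_prod_subtype_ne [Fintype J] [DecidableEq J] [Fintype E] (m : J) (S : Matrix E E ℂ)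
    (f f' : J → E) :
    ∑ g : {i // i ≠ m} → E, ∏ i : {i // i ≠ m}, (S (f i) (g i) * star (S (f' i) (g i))) =
      ∏ i ∈ Finset.univ.erase m, (S * Sᴴ) (f i) (f' i) := by
  rw [← Fintype.piFinset_univ, ← Finset.prod_univ_sum (fun _ : {i // i ≠ m} => Finset.univ)
    (fun i e => S (f i) e * star (S (f' i) e))]
  rw [Finset.prod_subtype (F := inferInstance) (Finset.univ.erase m) (p := fun i => i ≠ m)
    (by simp)]
  simp [Matrix.mul_apply]

end Encoder

/-! ### The joint state after encoding -/

section Received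

variable {A B C E₁ E₂ : Type*} [Fintype E₁] [Fintype E₂]

/-- If `V` prepares `ψ` from the purifications with the coefficient matrices `S₁`, `S₂`, then after
the encoding of `m` Bob's copy `m.1` and Charlie's copy `m.2` are in the state `ψ` with Alice's
output, and the other copies are in the product of their marginal states. -/
theorem exists_encoder_copies {k₁ k₂ : ℕ} [Fintype A] {S₁ : Matrix E₁ E₁ ℂ} {S₂ : Matrix E₂ E₂ ℂ}
    {ψ : Matrix (A × (E₁ × E₂)) (A × (E₁ × E₂)) ℂ}
    {V : Matrix (E₁ × E₂) (E₁ × E₂) ℂ →ₗ[ℂ] Matrix A A ℂ} (hV : IsChannel V)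
    (hVψ : ∀ r r' a a', V (Matrix.of fun e e' => (S₁ ⊗ₖ S₂) r e * star ((S₁ ⊗ₖ S₂) r' e')) a a' =
      ψ (a, r) (a', r')) :
    ∃ enc : Matrix ((Fin k₁ × Fin k₂) × ((Fin k₁ → E₁) × (Fin k₂ → E₂)))
        ((Fin k₁ × Fin k₂) × ((Fin k₁ → E₁) × (Fin k₂ → E₂))) ℂ →ₗ[ℂ] Matrix A A ℂ,
      IsChannel enc ∧ ∀ m : Fin k₁ × Fin k₂,
        actLeft enc (pureState fun x : ((Fin k₁ × Fin k₂) × ((Fin k₁ → E₁) × (Fin k₂ → E₂))) ×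
          ((Fin k₁ → E₁) × (Fin k₂ → E₂)) => (if x.1.1 = m then 1 else 0) *
            (copies S₁ (x.1.2.1, x.2.1) * copies S₂ (x.1.2.2, x.2.2))) =
        Matrix.of fun x y =>
          (∏ i ∈ Finset.univ.erase m.1, (S₁ * S₁ᴴ) (x.2.1 i) (y.2.1 i)) *
          (∏ i ∈ Finset.univ.erase m.2, (S₂ * S₂ᴴ) (x.2.2 i) (y.2.2 i)) *
          ψ (x.1, (x.2.1 m.1, x.2.2 m.2)) (y.1, (y.2.1 m.1, y.2.2 m.2)) := by
  obtain ⟨enc, henc, h⟩ := exists_encoder (k₁ := k₁) (k₂ := k₂) hV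
  refine ⟨enc, henc, fun m => ?_⟩
  ext ⟨a, f₁, f₂⟩ ⟨a', f₁', f₂'⟩
  simp only [actLeft, Matrix.of_apply, h]
  rw [Finset.sum_eq_single m _ (by simp)]
  -- The unselected copies enter only as scalars, which pass through `V`; what remains is a block of
  -- the purification on the selected pair.
  · have key : ∀ (g₁ : {i // i ≠ m.1} → E₁) (g₂ : {i // i ≠ m.2} → E₂),
        (Matrix.of fun c c' : E₁ × E₂ => pureState (fun x : ((Fin k₁ × Fin k₂) ×
          ((Fin k₁ → E₁) × (Fin k₂ → E₂))) × ((Fin k₁ → E₁) × (Fin k₂ → E₂)) =>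
          (if x.1.1 = m then 1 else 0) *
            (copies S₁ (x.1.2.1, x.2.1) * copies S₂ (x.1.2.2, x.2.2)))
          ((m, ((Equiv.funSplitAt m.1 E₁).symm (c.1, g₁),
            (Equiv.funSplitAt m.2 E₂).symm (c.2, g₂))), (f₁, f₂))
          ((m, ((Equiv.funSplitAt m.1 E₁).symm (c'.1, g₁),
            (Equiv.funSplitAt m.2 E₂).symm (c'.2, g₂))), (f₁', f₂'))) =
        ((∏ i : {i // i ≠ m.1}, (S₁ (f₁ i) (g₁ i) * star (S₁ (f₁' i) (g₁ i)))) *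
          ∏ i : {i // i ≠ m.2}, (S₂ (f₂ i) (g₂ i) * star (S₂ (f₂' i) (g₂ i)))) •
        Matrix.of fun e e' => (S₁ ⊗ₖ S₂) (f₁ m.1, f₂ m.2) e *
          star ((S₁ ⊗ₖ S₂) (f₁' m.1, f₂' m.2) e') := fun g₁ g₂ => by
      ext c c'
      simp only [pureState, vecMulVec_apply, copies, Matrix.of_apply, Pi.star_apply, if_true,
        one_mul, Matrix.smul_apply, smul_eq_mul, kroneckerMap_apply, Finset.prod_mul_distrib,
        prod_funSplitAt m.1 (fun i e => S₁ (f₁ i) e),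
        prod_funSplitAt m.1 (fun i e => S₁ (f₁' i) e),
        prod_funSplitAt m.2 (fun i e => S₂ (f₂ i) e),
        prod_funSplitAt m.2 (fun i e => S₂ (f₂' i) e), star_mul', star_prod]
      ring
    simp only [key, map_smul, Matrix.sum_apply, Matrix.smul_apply, hVψ, smul_eq_mul,
      ← Finset.sum_mul, ← Finset.mul_sum, sum_prod_subtype_ne]
  · intro m' _ hm'
    refine Finset.sum_eq_zero fun g₁ _ => Finset.sum_eq_zero fun g₂ _ => ?_
    simp only [pureState, vecMulVec_apply, if_neg hm', zero_mul]
    exact map_zero V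

end Received

/-! ### The receivers' marginal states -/

section Marginals

variable {A B C E F : Type*}

theorem trace_marg12 [Fintype A] [Fintype E] [Fintype F]
    (ψ : Matrix (A × (E × F)) (A × (E × F)) ℂ) : (marg12 ψ).trace = ψ.trace := by
  simp [marg12, Matrix.trace, Fintype.sum_prod_type]

theorem trace_marg13 [Fintype A] [Fintype E] [Fintype F]
    (ψ : Matrix (A × (E × F)) (A × (E × F)) ℂ) : (marg13 ψ).trace = ψ.trace := by
  simp only [marg13, Matrix.trace, Matrix.diag, Fintype.sum_prod_type, Matrix.of_apply]
  exact Finset.sum_congr rfl fun a _ => Finset.sum_comm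

theorem IsState.marg12 [Fintype A] [Fintype E] [Fintype F]
    {ψ : Matrix (A × (E × F)) (A × (E × F)) ℂ} (hψ : IsState ψ) : IsState (marg12 ψ) := by
  refine ⟨?_, (trace_marg12 ψ).trans hψ.2⟩
  have : QBroadcast.marg12 ψ = ∑ f, ψ.submatrix (fun x => (x.1, (x.2, f)))
      (fun x => (x.1, (x.2, f))) := by
    ext x y; simp [QBroadcast.marg12, Matrix.sum_apply]
  rw [this]
  exact posSemidef_sum _ fun f _ => hψ.1.submatrix _

theorem IsState.marg13 [Fintype A] [Fintype E] [Fintype F]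
    {ψ : Matrix (A × (E × F)) (A × (E × F)) ℂ} (hψ : IsState ψ) : IsState (marg13 ψ) := by
  refine ⟨?_, (trace_marg13 ψ).trans hψ.2⟩
  have : QBroadcast.marg13 ψ = ∑ e, ψ.submatrix (fun x => (x.1, (e, x.2)))
      (fun x => (x.1, (e, x.2))) := by
    ext x y; simp [QBroadcast.marg13, Matrix.sum_apply]
  rw [this]
  exact posSemidef_sum _ fun f _ => hψ.1.submatrix _

theorem IsState.trLeft [Fintype A] [Fintype E] {ψ : Matrix (A × E) (A × E) ℂ} (hψ : IsState ψ) :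
    IsState (trLeft ψ) :=
  ⟨posSemidef_trLeft hψ.1, (trace_trLeft ψ).trans hψ.2⟩

theorem IsState.actLeft [Fintype A] [Fintype B] [Fintype E] {ψ : Matrix (A × E) (A × E) ℂ}
    (hψ : IsState ψ) {N : Matrix A A ℂ →ₗ[ℂ] Matrix B B ℂ} (hN : IsChannel N) :
    IsState (actLeft N ψ) :=
  ⟨hN.posSemidef_actLeft hψ.1, (trace_actLeft hN.trace_preserving ψ).trans hψ.2⟩

theorem trRight_marg12 [Fintype E] [Fintype F] (ψ : Matrix (A × (E × F)) (A × (E × F)) ℂ) :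
    trRight (marg12 ψ) = trRight ψ := by
  ext a a'
  simp [trRight, marg12, Fintype.sum_prod_type]

theorem trRight_marg13 [Fintype E] [Fintype F] (ψ : Matrix (A × (E × F)) (A × (E × F)) ℂ) :
    trRight (marg13 ψ) = trRight ψ := by
  ext a a'
  simp [trRight, marg13, Fintype.sum_prod_type_right]

variable {J₁ J₂ : Type*} [Fintype J₁] [DecidableEq J₁] [Fintype J₂] [DecidableEq J₂]

/-- Charlie's unselected copies have trace one and disappear, and tracing out his selected copy
reduces ψ to its marginal on Alice and Bob. Hence the result is independent of `m₂`. -/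
theorem margFirst_actLeft [Fintype C] [Fintype F]
    (N : Matrix A A ℂ →ₗ[ℂ] Matrix (B × C) (B × C) ℂ) {ω₁ : Matrix E E ℂ} {ω₂ : Matrix F F ℂ}
    (hω₂ : ω₂.trace = 1) (ψ : Matrix (A × (E × F)) (A × (E × F)) ℂ) (m₁ : J₁) (m₂ : J₂) :
    margFirst (actLeft N (Matrix.of fun x y : A × ((J₁ → E) × (J₂ → F)) =>
      (∏ i ∈ Finset.univ.erase m₁, ω₁ (x.2.1 i) (y.2.1 i)) *
      (∏ i ∈ Finset.univ.erase m₂, ω₂ (x.2.2 i) (y.2.2 i)) *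
      ψ (x.1, (x.2.1 m₁, x.2.2 m₂)) (y.1, (y.2.1 m₁, y.2.2 m₂)))) =
    placed (actLeft (trRight ∘ₗ N) (marg12 ψ)) ω₁ m₁ := by
  ext ⟨b, f⟩ ⟨b', f'⟩
  simp only [margFirst, actLeft, placed, Matrix.of_apply, LinearMap.comp_apply]
  have h : ∀ c, ∑ g : J₂ → F, N (Matrix.of fun a a' =>
      (∏ i ∈ Finset.univ.erase m₁, ω₁ (f i) (f' i)) *
      (∏ i ∈ Finset.univ.erase m₂, ω₂ (g i) (g i)) *
      ψ (a, (f m₁, g m₂)) (a', (f' m₁, g m₂))) (b, c) (b', c) =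
      (∏ i ∈ Finset.univ.erase m₁, ω₁ (f i) (f' i)) *
      N (Matrix.of fun a a' => marg12 ψ (a, f m₁) (a', f' m₁)) (b, c) (b', c) := fun c => by
    rw [← Matrix.sum_apply, ← map_sum]
    have : ∑ g : J₂ → F, (Matrix.of fun a a' =>
        (∏ i ∈ Finset.univ.erase m₁, ω₁ (f i) (f' i)) *
        (∏ i ∈ Finset.univ.erase m₂, ω₂ (g i) (g i)) *
        ψ (a, (f m₁, g m₂)) (a', (f' m₁, g m₂))) =
        (∏ i ∈ Finset.univ.erase m₁, ω₁ (f i) (f' i)) •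
        Matrix.of fun a a' => marg12 ψ (a, f m₁) (a', f' m₁) := by
      ext a a'
      have e := sum_mul_prod_erase m₂ (fun r => ψ (a, (f m₁, r)) (a', (f' m₁, r)))
        (fun _ r => ω₂ r r)
      rw [show ∑ r, ω₂ r r = 1 from hω₂, Finset.prod_const_one, mul_one] at e
      simp only [Matrix.sum_apply, Matrix.of_apply, Matrix.smul_apply, smul_eq_mul, marg12, ← e,
        Finset.mul_sum]
      exact Finset.sum_congr rfl fun g _ => by ring
    rw [this, map_smul, Matrix.smul_apply, smul_eq_mul]
  simp only [h, ← Finset.mul_sum]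
  rw [mul_comm]
  rfl

theorem margSecond_actLeft [Fintype B] [Fintype E]
    (N : Matrix A A ℂ →ₗ[ℂ] Matrix (B × C) (B × C) ℂ) {ω₁ : Matrix E E ℂ} {ω₂ : Matrix F F ℂ}
    (hω₁ : ω₁.trace = 1) (ψ : Matrix (A × (E × F)) (A × (E × F)) ℂ) (m₁ : J₁) (m₂ : J₂) :
    margSecond (actLeft N (Matrix.of fun x y : A × ((J₁ → E) × (J₂ → F)) =>
      (∏ i ∈ Finset.univ.erase m₁, ω₁ (x.2.1 i) (y.2.1 i)) *
      (∏ i ∈ Finset.univ.erase m₂, ω₂ (x.2.2 i) (y.2.2 i)) *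
      ψ (x.1, (x.2.1 m₁, x.2.2 m₂)) (y.1, (y.2.1 m₁, y.2.2 m₂)))) =
    placed (actLeft (trLeft ∘ₗ N) (marg13 ψ)) ω₂ m₂ := by
  ext ⟨c, f⟩ ⟨c', f'⟩
  simp only [margSecond, actLeft, placed, Matrix.of_apply, LinearMap.comp_apply]
  have h : ∀ b, ∑ g : J₁ → E, N (Matrix.of fun a a' =>
      (∏ i ∈ Finset.univ.erase m₁, ω₁ (g i) (g i)) *
      (∏ i ∈ Finset.univ.erase m₂, ω₂ (f i) (f' i)) *
      ψ (a, (g m₁, f m₂)) (a', (g m₁, f' m₂))) (b, c) (b, c') =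
      (∏ i ∈ Finset.univ.erase m₂, ω₂ (f i) (f' i)) *
      N (Matrix.of fun a a' => marg13 ψ (a, f m₂) (a', f' m₂)) (b, c) (b, c') := fun b => by
    rw [← Matrix.sum_apply, ← map_sum]
    have : ∑ g : J₁ → E, (Matrix.of fun a a' =>
        (∏ i ∈ Finset.univ.erase m₁, ω₁ (g i) (g i)) *
        (∏ i ∈ Finset.univ.erase m₂, ω₂ (f i) (f' i)) *
        ψ (a, (g m₁, f m₂)) (a', (g m₁, f' m₂))) =
        (∏ i ∈ Finset.univ.erase m₂, ω₂ (f i) (f' i)) •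
        Matrix.of fun a a' => marg13 ψ (a, f m₂) (a', f' m₂) := by
      ext a a'
      have e := sum_mul_prod_erase m₁ (fun r => ψ (a, (r, f m₂)) (a', (r, f' m₂)))
        (fun _ r => ω₁ r r)
      rw [show ∑ r, ω₁ r r = 1 from hω₁, Finset.prod_const_one, mul_one] at e
      simp only [Matrix.sum_apply, Matrix.of_apply, Matrix.smul_apply, smul_eq_mul, marg13, ← e,
        Finset.mul_sum]
      exact Finset.sum_congr rfl fun g _ => by ring
    rw [this, map_smul, Matrix.smul_apply, smul_eq_mul]
  simp only [h, ← Finset.mul_sum]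
  rw [mul_comm]
  rfl

end Marginals

end QBroadcast

/-! ### Assembling the broadcast code -/

theorem theorem6 {A B C B' C' : Type u}
    [Fintype A] [Fintype B] [Fintype C] [Fintype B'] [Fintype C']
    [DecidableEq B] [DecidableEq C] [DecidableEq B'] [DecidableEq C']
    (N : Matrix A A ℂ →ₗ[ℂ] Matrix (B × C) (B × C) ℂ) (hN : IsChannel N)
    (ε₁ ε₂ δ : ℝ) (hε₁ : ε₁ ∈ Set.Ioo (0 : ℝ) 1) (hε₂ : ε₂ ∈ Set.Ioo (0 : ℝ) 1)
    (hδ : δ ∈ Set.Ioo (0 : ℝ) 1) (hδ₁ : δ ≤ ε₁) (hδ₂ : δ ≤ ε₂)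
    (ψ : Matrix (A × (B' × C')) (A × (B' × C')) ℂ) (hψ : IsState ψ)
    (hprod : trLeft ψ = trLeft (marg12 ψ) ⊗ₖ trLeft (marg13 ψ))
    (R₁ R₂ : ℝ) (hR₁ : 0 ≤ R₁) (hR₂ : 0 ≤ R₂)
    (h₁ : (R₁ : EReal) ≤
      DH ε₁ (actLeft (trRight ∘ₗ N) (marg12 ψ))
        ((trRight ∘ₗ N) (trRight ψ) ⊗ₖ trLeft (marg12 ψ))
      - ((Real.logb 2 (4 * ε₁ / δ ^ 2) : ℝ) : EReal))
    (h₂ : (R₂ : EReal) ≤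
      DH ε₂ (actLeft (trLeft ∘ₗ N) (marg13 ψ))
        ((trLeft ∘ₗ N) (trRight ψ) ⊗ₖ trLeft (marg13 ψ))
      - ((Real.logb 2 (4 * ε₂ / δ ^ 2) : ℝ) : EReal)) :
    HasEACode N R₁ R₂ (ε₁ + δ) (ε₂ + δ) := by
  have hA : Nonempty A := by
    by_contra h
    rw [not_nonempty_iff] at h
    simpa [Matrix.trace] using hψ.2
  have hω₁ := hψ.marg12.trLeft
  have hω₂ := hψ.marg13.trLeft
  obtain ⟨S₁, G₁, hS₁, hG₁, hSS₁, hc₁, hSGS₁⟩ := exists_sqrt_pinv hω₁.1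
  obtain ⟨S₂, G₂, hS₂, hG₂, hSS₂, hc₂, hSGS₂⟩ := exists_sqrt_pinv hω₂.1
  have hSS₁' : S₁ * S₁.conjTranspose = trLeft (marg12 ψ) := by rw [hS₁.1.eq, hSS₁]
  have hSS₂' : S₂ * S₂.conjTranspose = trLeft (marg13 ψ) := by rw [hS₂.1.eq, hSS₂]
  -- The product hypothesis enters here: it makes `S₁ ⊗ₖ S₂` a square root of ψ_{B'C'}, so its
  -- purification splits into one shared with Bob and one shared with Charlie.
  obtain ⟨V, hV, hVψ⟩ := exists_channel_of_marginal hψ.1 (S := S₁ ⊗ₖ S₂) (G := G₁ ⊗ₖ G₂)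
    (hS₁.kronecker hS₂).1 (hG₁.kronecker hG₂).1
    (by rw [← Matrix.mul_kronecker_mul, hSS₁, hSS₂, hprod])
    (by rw [← Matrix.mul_kronecker_mul, ← Matrix.mul_kronecker_mul, hc₁, hc₂])
    (by rw [← Matrix.mul_kronecker_mul, ← Matrix.mul_kronecker_mul, hSGS₁, hSGS₂])
  obtain ⟨enc, henc, hrec⟩ := exists_encoder_copies (k₁ := ⌊(2 : ℝ) ^ R₁⌋₊)
    (k₂ := ⌊(2 : ℝ) ^ R₂⌋₊) hV hVψ
  rw [hSS₁', hSS₂'] at hrec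
  -- The channel output of ψ_A is the marginal of the receiver's joint state, which is the form in
  -- which the wrong copies appear in the decoder.
  rw [← trRight_marg12, ← trRight_actLeft] at h₁
  rw [← trRight_marg13, ← trRight_actLeft] at h₂
  obtain ⟨D₁, hD₁, he₁⟩ :=
    exists_decoder (hψ.marg12.actLeft hN.trRight_comp) hω₁ hδ.1 hδ₁ hR₁ h₁
  obtain ⟨D₂, hD₂, he₂⟩ :=
    exists_decoder (hψ.marg13.actLeft hN.trLeft_comp) hω₂ hδ.1 hδ₂ hR₂ h₂
  let c : EACode A B C ⌊(2 : ℝ) ^ R₁⌋₊ ⌊(2 : ℝ) ^ R₂⌋₊ :=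
    { EA₁ := Fin ⌊(2 : ℝ) ^ R₁⌋₊ → B'
      EB := Fin ⌊(2 : ℝ) ^ R₁⌋₊ → B'
      EA₂ := Fin ⌊(2 : ℝ) ^ R₂⌋₊ → C'
      EC := Fin ⌊(2 : ℝ) ^ R₂⌋₊ → C'
      θ₁ := copies S₁
      θ₂ := copies S₂
      isKet_θ₁ := isKet_copies (by rw [hSS₁', hω₁.2])
      isKet_θ₂ := isKet_copies (by rw [hSS₂', hω₂.2])
      enc := enc
      isChannel_enc := henc
      decB := D₁
      isChannel_decB := hD₁
      decC := D₂
      isChannel_decC := hD₂ }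
  have hreceived : ∀ m₁ m₂, c.received N m₁ m₂ = _ := fun m₁ m₂ =>
    congrArg (actLeft N) (hrec (m₁, m₂))
  refine ⟨c, fun m₁ m₂ => ⟨?_, ?_⟩⟩
  · rw [EACode.errB, hreceived, margFirst_actLeft N hω₂.2]
    exact he₁ m₁
  · rw [EACode.errC, hreceived, margSecond_actLeft N hω₁.2]
    exact he₂ m₂
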